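/- Let $n\ge 1$, let $V_{n-1}=\{x\in\mathbb{R}^n : x_1+x_2+\cdots+x_n=0\}$, and let $\underline{a}=(a_1,\ldots,a_n)$ be a vector of nonnegative real numbers. The $\underline{a}$-generalized Linial arrangement is the set of the hyperplanes $$x_i-x_j=a_i\qquad (1\le i<j\le n)$$ in $V_{n-1}$; its regions are the connected components of the complement in $V_{n-1}$ of the union of these hyperplanes. Let $H_{2n-1}$ denote the median Genocchi numbers (Genocchi numbers of the second kind) $H_1,H_3,H_5,H_7,H_9,\ldots=1,2,8,56,608,\ldots$; that is, $H_{2n-1}=g(2n,1)$, where the Seidel triangle $g(r,k)$ ($r\ge 1$, $1\le k\le\lceil r/2\rceil$; $g(r,k)=0$ for $k>\lceil r/2\rceil$) is defined by $g(1,1)=1$, $g(2i,k)=\sum_{l=k}^{i}g(2i-1,l)$ for $i\geq 1$, $1\le k\le i$, and $g(2i+1,k)=\sum_{l=1}^{k}g(2i,l)$ for $i\geq 1$, $1\le k\le i+1$. Then the number of regions of the $\underline{a}$-generalized Linial arrangement in $V_{n-1}$ is at most $H_{2n-1}$ (in particular it is finite). -/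

import Mathlib

/-- The hyperplane `x_1 + ⋯ + x_n = 0` of `ℝⁿ` (written `V_{n-1}`), as a linear subspace. -/
def sumZeroSpace (n : ℕ) : Submodule ℝ (EuclideanSpace ℝ (Fin n)) where
  carrier := {x | ∑ i, x i = 0}
  zero_mem' := by simp
  add_mem' := by
    intro x y hx hy
    simp only [Set.mem_ofPred_eq] at hx hy ⊢
    simp [Finset.sum_add_distrib, hx, hy]
  smul_mem' := by
    intro c x hx
    simp only [Set.mem_ofPred_eq] at hx ⊢
    simp [← Finset.mul_sum, hx]

/-- The `a`-generalized Linial arrangement: the set of all the hyperplanes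
`{x | x_i - x_j = a_i}`, `i < j`, of `V_{n-1}`. -/
def generalizedLinialArrangement {n : ℕ} (a : Fin n → ℝ) : Set (Set (sumZeroSpace n)) :=
  {H | ∃ i j : Fin n, i < j ∧ H = {x | x.1 i - x.1 j = a i}}

/-- The regions of an arrangement `𝒜` of hyperplanes of `E`: the connected components of the
complement in `E` of the union of the hyperplanes. -/
def arrangementRegions {E : Type*} [TopologicalSpace E] (𝒜 : Set (Set E)) : Set (Set E) :=
  {R | ∃ x ∈ (⋃₀ 𝒜)ᶜ, R = connectedComponentIn (⋃₀ 𝒜)ᶜ x}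

/-- The Seidel triangle of the Genocchi numbers; `seidelTriangle r k` is the `k`-th entry of the
`r`-th row. Rows and entries are numbered from `1`, the `r`-th row has `⌈r/2⌉` entries, and the
value is `0` outside of the triangle. The first row is `1`; an even row consists of the
sums of the final segments of the row above it, an odd row of the sums of the initial segments:
`1 / 1 / 1 1 / 2 1 / 2 3 3 / 8 6 3 / 8 14 17 17 / 56 48 34 17 / …` -/
def seidelTriangle : ℕ → ℕ → ℕ
  | 0, _ => 0
  | 1, k => if k = 1 then 1 else 0
  | m + 2, k =>
    if 1 ≤ k ∧ k ≤ (m + 3) / 2 then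
      if Even m then ∑ l ∈ Finset.Icc k ((m + 2) / 2), seidelTriangle (m + 1) l
      else ∑ l ∈ Finset.Icc 1 k, seidelTriangle (m + 1) l
    else 0

/-- `medianGenocchi n`, for `n ≥ 1`, is the median Genocchi number `H_{2n-1}` (the Genocchi number
of the second kind), that is, the first entry of row `2n` of the Seidel triangle:
`H_1, H_3, H_5, H_7, H_9, … = 1, 2, 8, 56, 608, …` -/
def medianGenocchi (n : ℕ) : ℕ := seidelTriangle (2 * n) 1

/-!
Whether a point lies on one side or the other of each set `u i = w j` determines its region. Reading
`u i` as a threshold and `w j` as the value of a label `j`, this is a code recording, in the rounds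
`i = n - 2, …, 0`, which labels `j > i` lie below the threshold, so it remains to count the codes
which arise when the values and the thresholds are arbitrary real numbers.

Let `G_m(k)` be the number of codes of `m` rounds starting from `k` ordered labels. In a round, the
set below the threshold is one of `k + 1` initial segments, and a new label then enters in one of
`k + 1` places. A code which is possible for two different places is possible for all the places in
between: it separates the new label from none of the labels it passes, so swapping them changes
nothing. Consecutive places thus share exactly the codes which do not separate the new label from
the old one next to it, and merging the two labels counts these by `G_m(k)`. This gives
`G_{m+1}(k) = (k + 1) ((k + 1) G_m(k + 1) - k G_m(k))`, and `G_m(1)` is identified with `H_{2m+1}`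
through a linear functional on `ℤ[X]` for which `X ^ a * (X + 1) ^ b` is sent to a signed entry of
the Seidel triangle, Pascal's rule for these polynomials being the recursion of the triangle.
-/

section SeidelTriangle

theorem seidelTriangle_eq_zero_of_lt {r k : ℕ} (h : (r + 1) / 2 < k) : seidelTriangle r k = 0 := by
  match r with
  | 0 => rw [seidelTriangle]
  | 1 => rw [seidelTriangle, if_neg (by omega)]
  | m + 2 => rw [seidelTriangle, if_neg (by omega)]

theorem seidelTriangle_zero_right (r : ℕ) : seidelTriangle r 0 = 0 := by
  match r with
  | 0 => rw [seidelTriangle]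
  | 1 => rw [seidelTriangle, if_neg zero_ne_one]
  | m + 2 => rw [seidelTriangle, if_neg (by simp)]

theorem seidelTriangle_even_row_eq_sum (i k : ℕ) :
    seidelTriangle (2 * i + 2) (k + 1)
      = ∑ l ∈ Finset.Icc (k + 1) (i + 1), seidelTriangle (2 * i + 1) l := by
  rw [seidelTriangle]
  split_ifs with hk hi
  · congr 2
    omega
  · exact absurd (even_two_mul i) hi
  · rw [Finset.Icc_eq_empty (by omega), Finset.sum_empty]

theorem seidelTriangle_odd_row_eq_sum {i k : ℕ} (hk : k ≤ i + 2) :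
    seidelTriangle (2 * i + 3) k = ∑ l ∈ Finset.Icc 1 k, seidelTriangle (2 * i + 2) l := by
  rw [seidelTriangle]
  split_ifs with hk' hi
  · exact absurd (odd_two_mul_add_one i) (Nat.not_odd_iff_even.2 hi)
  · rfl
  · rw [Finset.Icc_eq_empty (by omega), Finset.sum_empty]

theorem seidelTriangle_even_row {i k : ℕ} (hk : k ≤ i) :
    seidelTriangle (2 * i + 2) (k + 1)
      = seidelTriangle (2 * i + 1) (k + 1) + seidelTriangle (2 * i + 2) (k + 2) := by
  rw [seidelTriangle_even_row_eq_sum, seidelTriangle_even_row_eq_sum,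
    ← Finset.add_sum_Ioc_eq_sum_Icc (Nat.succ_le_succ hk), ← Finset.Icc_add_one_left_eq_Ioc]

theorem seidelTriangle_odd_row {i k : ℕ} (hk : k ≤ i + 1) :
    seidelTriangle (2 * i + 3) (k + 1)
      = seidelTriangle (2 * i + 3) k + seidelTriangle (2 * i + 2) (k + 1) := by
  rw [seidelTriangle_odd_row_eq_sum (Nat.succ_le_succ hk),
    seidelTriangle_odd_row_eq_sum (hk.trans (Nat.le_succ _)),
    Finset.sum_Icc_succ_top (Nat.le_add_left 1 k)]

end SeidelTriangle

/-- The values `G_m(k)` of Gandhi-type polynomials for the median Genocchi numbers: `G_m(1)` is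
`H_{2m+1}`, and `G_m(k)` turns out to count the codes of `m` rounds which start from `k` labels, see
`thresholdCodes` below. -/
def gandhiValue : ℕ → ℕ → ℤ
  | 0, _ => 1
  | m + 1, k => (k + 1) * ((k + 1) * gandhiValue m (k + 1) - k * gandhiValue m k)

/-- The moments of `genocchiFunctional`: up to sign, the last entries of the odd rows of the Seidel
triangle, and `0` in place of the entries which would follow the last ones of the even rows. The
value `-1` at `0` makes the functional vanish on `X + 1`, the case `k = 0` of the first row. -/
def genocchiMoment (m : ℕ) : ℤ :=
  if m = 0 then -1
  else if Even m then 0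
  else (-1) ^ (m / 2) * seidelTriangle m ((m + 1) / 2)

open Polynomial in
/-- The linear functional on `ℤ[X]` whose values on the `X ^ a * (X + 1) ^ b` with `b ≤ a + 1` are,
up to sign, the entries of the Seidel triangle. It transports the recursion of the triangle to
polynomial identities. -/
noncomputable def genocchiFunctional : ℤ[X] →ₗ[ℤ] ℤ :=
  Polynomial.lsum fun m => genocchiMoment m • LinearMap.id

namespace genocchiFunctional

open Polynomial

local notation "Λ" => genocchiFunctional

theorem apply_X_pow (m : ℕ) : Λ (X ^ m) = genocchiMoment m := by
  rw [← monomial_one_right_eq_X_pow, genocchiFunctional, Polynomial.lsum_apply,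
    Polynomial.sum_monomial_index] <;> simp

theorem apply_one : Λ 1 = -1 := by
  rw [← pow_zero X, apply_X_pow, genocchiMoment, if_pos rfl]

theorem apply_X_pow_even (m : ℕ) : Λ (X ^ (2 * m + 2)) = 0 := by
  rw [apply_X_pow, genocchiMoment, if_neg (by omega), if_pos (by simp [parity_simps])]

theorem apply_X_pow_odd (m : ℕ) :
    Λ (X ^ (2 * m + 1)) = (-1) ^ m * seidelTriangle (2 * m + 1) (m + 1) := by
  rw [apply_X_pow, genocchiMoment, if_neg (by omega), if_neg (by simp [parity_simps])]
  congr 3 <;> omega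

theorem map_int_mul (c : ℤ) (p : ℤ[X]) : Λ ((c : ℤ[X]) * p) = c * Λ p := by
  rw [← zsmul_eq_mul, map_zsmul, smul_eq_mul]

theorem apply_succ (a b : ℕ) :
    Λ (X ^ a * (X + 1) ^ (b + 1)) = Λ (X ^ (a + 1) * (X + 1) ^ b) + Λ (X ^ a * (X + 1) ^ b) := by
  rw [← map_add]
  congr 1
  ring

theorem apply_even_row_of_odd_row {i : ℕ}
    (hodd : ∀ {k b}, k + b = i + 1 →
      Λ (X ^ (i + k) * (X + 1) ^ b) = (-1) ^ i * seidelTriangle (2 * i + 1) k)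
    {k b : ℕ} (hkb : k + b = i + 1) :
    Λ (X ^ (i + 1 + k) * (X + 1) ^ b) = (-1) ^ i * seidelTriangle (2 * i + 2) (k + 1) := by
  induction b generalizing k with
  | zero =>
    obtain rfl : k = i + 1 := hkb
    rw [pow_zero, mul_one, ← two_mul, mul_add_one, apply_X_pow_even,
      seidelTriangle_eq_zero_of_lt (by omega), Nat.cast_zero, mul_zero]
  | succ b ih =>
    have hprev : k + 1 + b = i + 1 := by omega
    rw [apply_succ, add_assoc (i + 1), ih hprev, add_right_comm i 1 k, add_assoc i k, hodd hprev,
      seidelTriangle_even_row (by omega : k ≤ i)]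
    push_cast
    ring

theorem apply_odd_row {i k b : ℕ} (hkb : k + b = i + 1) :
    Λ (X ^ (i + k) * (X + 1) ^ b) = (-1) ^ i * seidelTriangle (2 * i + 1) k := by
  induction i generalizing k b with
  | zero =>
    have hX : Λ X = 1 := by simpa [seidelTriangle] using apply_X_pow_odd 0
    obtain ⟨rfl, rfl⟩ | ⟨rfl, rfl⟩ : k = 0 ∧ b = 1 ∨ k = 1 ∧ b = 0 := by omega
    · simp [hX, apply_one, seidelTriangle]
    · simp [hX, seidelTriangle]
  | succ i ih =>
    induction b generalizing k with
    | zero =>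
      obtain rfl : k = i + 1 + 1 := hkb
      rw [pow_zero, mul_one, ← add_assoc, ← two_mul, apply_X_pow_odd]
    | succ b ihb =>
      have hprev : k + 1 + b = i + 1 + 1 := by omega
      rw [apply_succ, add_assoc (i + 1), ihb hprev,
        apply_even_row_of_odd_row ih (by omega : k + b = i + 1), mul_add_one 2 i,
        seidelTriangle_odd_row (by omega : k ≤ i + 1)]
      push_cast
      ring

theorem apply_median (i : ℕ) :
    Λ ((X * (X + 1)) ^ (i + 1)) = (-1) ^ i * medianGenocchi (i + 1) := by
  have h := apply_even_row_of_odd_row apply_odd_row (zero_add (i + 1))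
  rw [add_zero, zero_add] at h
  rw [mul_pow, h, medianGenocchi, mul_add_one]

theorem apply_X_add_one_mul (j : ℕ) : Λ ((X + 1) * (X * (X + 1)) ^ j) = 0 := by
  have h := apply_odd_row (zero_add (j + 1))
  rw [add_zero, seidelTriangle_zero_right, Nat.cast_zero, mul_zero] at h
  rw [← h, mul_pow, pow_succ]
  congr 1
  ring

/-- The product of the `X (X + 1) - i (i + 1)` with `1 ≤ i ≤ k`. The values of `genocchiFunctional`
on its multiples by powers of `X (X + 1)` are those of `gandhiValue` up to a factor. -/
noncomputable def pronicProduct (k : ℕ) : ℤ[X] :=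
  ∏ i ∈ Finset.range k, (X * (X + 1) - (((i + 1) * (i + 2) : ℤ) : ℤ[X]))

/-- The product of the `X ^ 2 - i ^ 2` with `1 ≤ i ≤ k`. It is an even polynomial, and
`genocchiFunctional` vanishes on the positive even powers of `X`. -/
noncomputable def squareProduct (k : ℕ) : ℤ[X] :=
  ∏ i ∈ Finset.range k, (X ^ 2 - (((i + 1) ^ 2 : ℤ) : ℤ[X]))

theorem pronicProduct_succ (k : ℕ) : pronicProduct (k + 1)
    = pronicProduct k * (X * (X + 1) - (((k + 1) * (k + 2) : ℤ) : ℤ[X])) :=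
  Finset.prod_range_succ _ _

theorem squareProduct_succ (k : ℕ) :
    squareProduct (k + 1) = squareProduct k * (X ^ 2 - (((k + 1) ^ 2 : ℤ) : ℤ[X])) :=
  Finset.prod_range_succ _ _

-- Both sides are the product of the `X + i` with `-k ≤ i ≤ k + 1`, divided by `X`.
theorem X_add_one_mul_pronicProduct (k : ℕ) :
    (X + 1) * pronicProduct k = squareProduct k * (X + ((k + 1 : ℤ) : ℤ[X])) := by
  induction k with
  | zero => simp [pronicProduct, squareProduct]
  | succ k ih =>
    rw [pronicProduct_succ, squareProduct_succ, ← mul_assoc, ih]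
    push_cast
    ring

theorem apply_X_add_one_mul_pronicProduct (k j : ℕ) :
    Λ ((X + 1) * (X * (X + 1)) ^ j * pronicProduct k) = 0 := by
  induction k generalizing j with
  | zero => simpa [pronicProduct] using apply_X_add_one_mul j
  | succ k ih =>
    have hsucc : (X + 1 : ℤ[X]) * (X * (X + 1)) ^ j * pronicProduct (k + 1)
        = (X + 1) * (X * (X + 1)) ^ (j + 1) * pronicProduct k
          - (((k + 1) * (k + 2) : ℤ) : ℤ[X]) * ((X + 1) * (X * (X + 1)) ^ j * pronicProduct k) := by
      rw [pronicProduct_succ]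
      ring
    rw [hsucc, map_sub, map_int_mul, ih, ih, mul_zero, sub_zero]

theorem apply_X_pow_even_mul_squareProduct (k j : ℕ) :
    Λ (X ^ (2 * j + 2) * squareProduct k) = 0 := by
  induction k generalizing j with
  | zero => simpa [squareProduct] using apply_X_pow_even j
  | succ k ih =>
    have hsucc : X ^ (2 * j + 2) * squareProduct (k + 1)
        = X ^ (2 * (j + 1) + 2) * squareProduct k
          - (((k + 1) ^ 2 : ℤ) : ℤ[X]) * (X ^ (2 * j + 2) * squareProduct k) := by
      rw [squareProduct_succ]
      ring
    rw [hsucc, map_sub, map_int_mul, ih, ih, mul_zero, sub_zero]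

theorem apply_X_sq_mul_squareProduct (k : ℕ) : Λ (X ^ 2 * squareProduct k) = 0 :=
  apply_X_pow_even_mul_squareProduct k 0

theorem apply_squareProduct (k : ℕ) :
    Λ (squareProduct k) = (-1) ^ (k + 1) * (k.factorial : ℤ) ^ 2 := by
  induction k with
  | zero => simp [squareProduct, apply_one]
  | succ k ih =>
    have hsucc : squareProduct (k + 1)
        = X ^ 2 * squareProduct k - (((k + 1) ^ 2 : ℤ) : ℤ[X]) * squareProduct k := by
      rw [squareProduct_succ]
      ring
    rw [hsucc, map_sub, map_int_mul, apply_X_sq_mul_squareProduct, ih, Nat.factorial_succ]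
    push_cast
    ring

theorem apply_X_mul_squareProduct (k : ℕ) :
    Λ (X * squareProduct k) = (-1) ^ k * (k + 1) * (k.factorial : ℤ) ^ 2 := by
  have hsplit : (X + 1) * pronicProduct k
      = X * squareProduct k + ((k + 1 : ℤ) : ℤ[X]) * squareProduct k := by
    rw [X_add_one_mul_pronicProduct]
    ring
  have h := apply_X_add_one_mul_pronicProduct k 0
  rw [pow_zero, mul_one, hsplit, map_add, map_int_mul, apply_squareProduct] at h
  rw [eq_neg_of_add_eq_zero_left h]
  ring

theorem apply_X_mul_X_add_one_mul_pronicProduct (k : ℕ) :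
    Λ (X * (X + 1) * pronicProduct k) = (-1) ^ k * ((k + 1).factorial : ℤ) ^ 2 := by
  have hsplit : X * (X + 1) * pronicProduct k
      = X ^ 2 * squareProduct k + ((k + 1 : ℤ) : ℤ[X]) * (X * squareProduct k) := by
    rw [mul_assoc, X_add_one_mul_pronicProduct]
    ring
  rw [hsplit, map_add, map_int_mul, apply_X_sq_mul_squareProduct, apply_X_mul_squareProduct,
    Nat.factorial_succ]
  push_cast
  ring

-- Multiplying by `X (X + 1) = (X (X + 1) - (k + 1) (k + 2)) + (k + 1) (k + 2)` gives the recursion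
-- of `gandhiValue`.
theorem apply_pow_mul_pronicProduct (m k : ℕ) :
    Λ ((X * (X + 1)) ^ (m + 1) * pronicProduct k)
      = (-1) ^ (m + k) * ((k + 1).factorial : ℤ) ^ 2 * gandhiValue m (k + 1) := by
  induction m generalizing k with
  | zero => simp [apply_X_mul_X_add_one_mul_pronicProduct, gandhiValue]
  | succ m ih =>
    have hsucc : (X * (X + 1)) ^ (m + 1 + 1) * pronicProduct k
        = (X * (X + 1)) ^ (m + 1) * pronicProduct (k + 1)
          + (((k + 1) * (k + 2) : ℤ) : ℤ[X]) * ((X * (X + 1)) ^ (m + 1) * pronicProduct k) := by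
      rw [pronicProduct_succ]
      ring
    rw [hsucc, map_add, map_int_mul, ih, ih, gandhiValue, Nat.factorial_succ (k + 1)]
    push_cast
    ring

end genocchiFunctional

theorem gandhiValue_one (m : ℕ) : gandhiValue m 1 = medianGenocchi (m + 1) := by
  have h := genocchiFunctional.apply_pow_mul_pronicProduct m 0
  rw [genocchiFunctional.pronicProduct, Finset.prod_range_zero, mul_one,
    genocchiFunctional.apply_median, add_zero, zero_add, Nat.factorial_one, Nat.cast_one,
    one_pow, mul_one] at h
  exact (mul_left_cancel₀ (pow_ne_zero m (by norm_num)) h).symm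

section ThresholdCodes

/-- The codes of the ways to continue, by `m` further rounds, a linearly ordered list `l` of labels:
the round numbered `m` records the set of the labels below a new threshold, and then inserts the new
label `m` into the list. The rounds are numbered downwards, so that `m` counts the remaining ones
and the labels of `l` are to be at least `m`. -/
def thresholdCodes : ℕ → List ℕ → Finset (List (Finset ℕ))
  | 0, _ => {[]}
  | m + 1, l =>
    Finset.image₂ List.cons
      ((Finset.range (l.length + 1)).image fun i => (l.take i).toFinset)
      ((Finset.range (l.length + 1)).biUnion fun g => thresholdCodes m (l.take g ++ m :: l.drop g))

theorem mem_thresholdCodes_succ {m : ℕ} {l : List ℕ} {p : List (Finset ℕ)} :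
    p ∈ thresholdCodes (m + 1) l ↔ ∃ s₁ s₂ s₃ s₄ p', l = s₁ ++ s₂ ∧ l = s₃ ++ s₄ ∧
      p' ∈ thresholdCodes m (s₃ ++ m :: s₄) ∧ p = s₁.toFinset :: p' := by
  simp only [thresholdCodes, Finset.mem_image₂, Finset.mem_image, Finset.mem_biUnion,
    Finset.mem_range]
  constructor
  · rintro ⟨_, ⟨i, -, rfl⟩, p', ⟨g, -, hp⟩, rfl⟩
    exact ⟨_, _, _, _, p', (List.take_append_drop i l).symm, (List.take_append_drop g l).symm,
      hp, rfl⟩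
  · rintro ⟨s₁, s₂, s₃, s₄, p', h₁, h₂, hp, rfl⟩
    refine ⟨_, ⟨s₁.length, ?_, rfl⟩, p', ⟨s₃.length, ?_, ?_⟩, ?_⟩
    · rw [h₁, List.length_append]; omega
    · rw [h₂, List.length_append]; omega
    · rw [h₂]; simpa using hp
    · rw [h₁]; simp

/-- The lists of labels which `thresholdCodes m` is meant for: distinct labels, none of which is
inserted again in the remaining `m` rounds. -/
structure LabelList (m : ℕ) (l : List ℕ) : Prop where
  nodup : l.Nodup
  le_of_mem : ∀ c ∈ l, m ≤ c

namespace LabelList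

variable {m : ℕ} {l₁ l₂ : List ℕ} {a b : ℕ}

theorem insert (h : LabelList (m + 1) (l₁ ++ l₂)) : LabelList m (l₁ ++ m :: l₂) where
  nodup := List.nodup_middle.2 <| List.nodup_cons.2
    ⟨fun hm => (h.le_of_mem m hm).not_gt m.lt_succ_self, h.nodup⟩
  le_of_mem c hc := by
    rcases List.mem_cons.1 (List.perm_middle.mem_iff.1 hc) with rfl | hc
    · exact le_rfl
    · exact (Nat.le_succ m).trans (h.le_of_mem c hc)

theorem insert_after (h : LabelList (m + 1) (l₁ ++ a :: l₂)) :
    LabelList m (l₁ ++ a :: m :: l₂) := by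
  rw [List.append_cons] at h ⊢
  exact h.insert

theorem erase_middle (h : LabelList m (l₁ ++ b :: l₂)) : LabelList m (l₁ ++ l₂) where
  nodup := (List.nodup_cons.1 (List.nodup_middle.1 h.nodup)).2
  le_of_mem c hc := h.le_of_mem c (List.perm_middle.mem_iff.2 (List.mem_cons_of_mem b hc))

theorem notMem_of_middle (h : LabelList m (l₁ ++ b :: l₂)) : b ∉ l₁ ++ l₂ :=
  (List.nodup_cons.1 (List.nodup_middle.1 h.nodup)).1

end LabelList

section ComparisonCode

variable {α : Type*} [LinearOrder α]

/-- The code of the labels with values `V` and the thresholds `W`: the labels of `T` are there from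
the beginning, and `m` rounds follow, numbered downwards as in `thresholdCodes`. -/
def comparisonCode (V W : ℕ → α) (T : Finset ℕ) (m : ℕ) : List (Finset ℕ) :=
  (List.range m).reverse.map fun j => {c ∈ T ∪ Finset.Ioo j m | V c < W j}

variable {V V' W W' : ℕ → α} {T : Finset ℕ} {m a b : ℕ} {y : α}

theorem comparisonCode_succ (V W : ℕ → α) (T : Finset ℕ) (m : ℕ) :
    comparisonCode V W T (m + 1)
      = {c ∈ T | V c < W m} :: comparisonCode V W (insert m T) m := by
  simp only [comparisonCode, List.range_succ, List.reverse_append, List.reverse_singleton,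
    List.singleton_append, List.map_cons, List.cons.injEq]
  refine ⟨?_, List.map_congr_left fun j hj => ?_⟩
  · have hnone : Finset.Ioo m (m + 1) = ∅ := by
      ext c
      simp only [Finset.mem_Ioo, Finset.notMem_empty, iff_false]
      omega
    rw [hnone, Finset.union_empty]
  · have hj : j < m := by simpa using hj
    have halive : T ∪ Finset.Ioo j (m + 1) = insert m T ∪ Finset.Ioo j m := by
      ext c
      simp only [Finset.mem_union, Finset.mem_Ioo, Finset.mem_insert]
      grind
    rw [halive]

theorem comparisonCode_eq_iff : comparisonCode V W T m = comparisonCode V' W' T m ↔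
    ∀ j < m, ∀ c ∈ T ∪ Finset.Ioo j m, V c < W j ↔ V' c < W' j := by
  simp only [comparisonCode, List.map_inj_left, List.mem_reverse, List.mem_range,
    Finset.filter_inj']

theorem forall_mem_comparisonCode_iff (ha : a ∈ T) (hb : b ∈ T) :
    (∀ C ∈ comparisonCode V W T m, a ∈ C ↔ b ∈ C) ↔ ∀ j < m, V a < W j ↔ V b < W j := by
  simp [comparisonCode, ha, hb]

theorem mem_of_mem_comparisonCode (ha : a ∈ T) (hab : V a < V b) {C : Finset ℕ}
    (hC : C ∈ comparisonCode V W T m) (hb : b ∈ C) : a ∈ C := by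
  obtain ⟨j, -, rfl⟩ := List.mem_map.1 hC
  exact Finset.mem_filter.2
    ⟨Finset.mem_union_left _ ha, hab.trans (Finset.mem_filter.1 hb).2⟩

theorem comparisonCode_map_erase (hb : m ≤ b) :
    (comparisonCode V W T m).map (fun C => C.erase b) = comparisonCode V W (T.erase b) m := by
  simp only [comparisonCode, List.map_map]
  refine List.map_congr_left fun j _ => ?_
  ext c
  simp only [Function.comp_apply, Finset.mem_erase, Finset.mem_filter, Finset.mem_union,
    Finset.mem_Ioo]
  grind

theorem comparisonCode_update (h : ∀ j < m, V b < W j ↔ y < W j) :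
    comparisonCode (Function.update V b y) W T m = comparisonCode V W T m := by
  refine comparisonCode_eq_iff.2 fun j hj c _ => ?_
  rcases eq_or_ne c b with rfl | hc
  · rw [Function.update_self, h j hj]
  · rw [Function.update_of_ne hc]

theorem comparisonCode_update_of_notMem (hbT : b ∉ T) (hb : m ≤ b) :
    comparisonCode (Function.update V b y) W T m = comparisonCode V W T m := by
  refine comparisonCode_eq_iff.2 fun j _ c hc => ?_
  rw [Function.update_of_ne]
  rintro rfl
  rcases Finset.mem_union.1 hc with hc | hc
  · exact hbT hc
  · exact (Finset.mem_Ioo.1 hc).2.not_ge hb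

theorem comparisonCode_update_threshold :
    comparisonCode V (Function.update W m y) T m = comparisonCode V W T m :=
  comparisonCode_eq_iff.2 fun j hj c _ => by rw [Function.update_of_ne hj.ne]

theorem comparisonCode_comp_swap (h : ∀ j < m, V a < W j ↔ V b < W j) :
    comparisonCode (V ∘ Equiv.swap a b) W T m = comparisonCode V W T m := by
  refine comparisonCode_eq_iff.2 fun j hj c _ => ?_
  rw [Function.comp_apply, Equiv.swap_apply_def]
  split_ifs with hca hcb
  · rw [hca, h j hj]
  · rw [hcb, h j hj]
  · rfl

theorem exists_append_of_pairwise_lt {l : List ℕ} (h : l.Pairwise fun c d => V c < V d) (w : α) :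
    ∃ s₁ s₂, l = s₁ ++ s₂ ∧ (∀ c ∈ s₁, V c < w) ∧ ∀ c ∈ s₂, w ≤ V c := by
  induction l with
  | nil => exact ⟨[], [], by simp⟩
  | cons x l ih =>
    rw [List.pairwise_cons] at h
    rcases lt_or_ge (V x) w with hx | hx
    · obtain ⟨s₁, s₂, rfl, h₁, h₂⟩ := ih h.2
      exact ⟨x :: s₁, s₂, rfl, by simpa [hx] using h₁, h₂⟩
    · refine ⟨[], x :: l, rfl, by simp, ?_⟩
      simpa [hx] using fun c hc => hx.trans (h.1 c hc).le

theorem filter_toFinset_append_eq {s₁ s₂ : List ℕ} {w : α} (h₁ : ∀ c ∈ s₁, V c < w)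
    (h₂ : ∀ c ∈ s₂, w ≤ V c) : {c ∈ (s₁ ++ s₂).toFinset | V c < w} = s₁.toFinset := by
  ext c
  simp only [Finset.mem_filter, List.mem_toFinset, List.mem_append]
  exact ⟨fun ⟨hc, hw⟩ => hc.resolve_right fun hc => (h₂ c hc).not_gt hw,
    fun hc => ⟨Or.inl hc, h₁ c hc⟩⟩

theorem exists_pairwise_lt_of_nodup [NoMaxOrder α] [Nonempty α] {l : List ℕ} (hl : l.Nodup) :
    ∃ V : ℕ → α, l.Pairwise fun c d => V c < V d := by
  obtain ⟨f, hf⟩ := Nat.exists_strictMono α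
  refine ⟨fun c => f (l.idxOf c), List.pairwise_iff_getElem.2 fun i j hi hj hij => hf ?_⟩
  rwa [hl.idxOf_getElem i hi, hl.idxOf_getElem j hj]

theorem exists_threshold_of_pairwise_lt [NoMaxOrder α] [Nonempty α] {s₁ s₂ : List ℕ}
    (h : (s₁ ++ s₂).Pairwise fun c d => V c < V d) :
    ∃ w, (∀ c ∈ s₁, V c < w) ∧ ∀ c ∈ s₂, w ≤ V c := by
  rw [List.pairwise_append] at h
  cases s₂ with
  | nil =>
    obtain ⟨x, hx⟩ := (s₁.toFinset.image V).exists_le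
    obtain ⟨w, hw⟩ := exists_gt x
    exact ⟨w, fun c hc => (hx _ (by simpa using ⟨c, hc, rfl⟩)).trans_lt hw, by simp⟩
  | cons d s₂ =>
    refine ⟨V d, fun c hc => h.2.2 c hc d List.mem_cons_self, ?_⟩
    simpa using fun c hc => ((List.pairwise_cons.1 h.2.1).1 c hc).le

theorem pairwise_lt_update_of_append {s₁ s₂ : List ℕ}
    (h : (s₁ ++ s₂).Pairwise fun c d => V c < V d) (hb : b ∉ s₁ ++ s₂)
    (h₁ : ∀ c ∈ s₁, V c < y) (h₂ : ∀ c ∈ s₂, y < V c) :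
    (s₁ ++ b :: s₂).Pairwise fun c d => Function.update V b y c < Function.update V b y d := by
  have hV : ∀ c ∈ s₁ ++ s₂, Function.update V b y c = V c := fun c hc =>
    Function.update_of_ne (ne_of_mem_of_not_mem hc hb) y V
  have h' : (s₁ ++ s₂).Pairwise fun c d => Function.update V b y c < Function.update V b y d :=
    h.imp_of_mem fun hc hd hcd => by rwa [hV _ hc, hV _ hd]
  rw [List.forall_mem_append] at hV
  rw [List.pairwise_append] at h' ⊢
  refine ⟨h'.1, List.pairwise_cons.2 ⟨fun d hd => ?_, h'.2.1⟩,
    fun c hc => List.forall_mem_cons.2 ⟨?_, h'.2.2 c hc⟩⟩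
  · rw [Function.update_self, hV.2 d hd]
    exact h₂ d hd
  · rw [Function.update_self, hV.1 c hc]
    exact h₁ c hc

variable [DenselyOrdered α] [NoMaxOrder α]

theorem exists_gt_forall_lt_of_lt (s : Finset α) (x : α) :
    ∃ y, x < y ∧ ∀ z ∈ s, x < z → y < z := by
  induction s using Finset.induction_on with
  | empty => simpa using exists_gt x
  | insert z s _ ih =>
    obtain ⟨y, hxy, hy⟩ := ih
    rcases lt_or_ge x z with hz | hz
    · obtain ⟨t, hxt, ht⟩ := exists_between (lt_min hxy hz)
      rw [lt_min_iff] at ht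
      exact ⟨t, hxt, by simpa [ht.2] using fun u hu hxu => ht.1.trans (hy u hu hxu)⟩
    · exact ⟨y, hxy, by simpa [hz.not_gt] using hy⟩

theorem exists_gt_same_comparisons (V W : ℕ → α) (l : List ℕ) (m : ℕ) (x : α) :
    ∃ y, x < y ∧ (∀ c ∈ l, x < V c → y < V c) ∧ ∀ j < m, x < W j ↔ y < W j := by
  obtain ⟨y, hxy, hy⟩ :=
    exists_gt_forall_lt_of_lt (l.toFinset.image V ∪ (Finset.range m).image W) x
  refine ⟨y, hxy, fun c hc => hy _ ?_, fun j hj => ⟨hy _ ?_, hxy.trans⟩⟩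
  · exact Finset.mem_union_left _ (Finset.mem_image_of_mem V (List.mem_toFinset.2 hc))
  · exact Finset.mem_union_right _ (Finset.mem_image_of_mem W (Finset.mem_range.2 hj))

theorem exists_insert_pairwise_lt {l : List ℕ} (hl : l.Pairwise fun c d => V c < V d)
    (hm : m ∉ l) (W : ℕ → α) (T : Finset ℕ) :
    ∃ V' s₁ s₂, l = s₁ ++ s₂ ∧ ((s₁ ++ m :: s₂).Pairwise fun c d => V' c < V' d) ∧
      comparisonCode V' W T m = comparisonCode V W T m := by
  -- Raising the label `m` slightly breaks a possible tie with a label of `l`.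
  obtain ⟨y, hxy, hyV, hyW⟩ := exists_gt_same_comparisons V W l m (V m)
  obtain ⟨s₁, s₂, rfl, h₁, h₂⟩ := exists_append_of_pairwise_lt hl y
  exact ⟨Function.update V m y, s₁, s₂, rfl,
    pairwise_lt_update_of_append hl hm h₁ fun c hc =>
      hyV c (List.mem_append_right _ hc) (hxy.trans_le (h₂ c hc)),
    comparisonCode_update hyW⟩

theorem toFinset_append_cons (s₁ s₂ : List ℕ) (b : ℕ) :
    (s₁ ++ b :: s₂).toFinset = insert b (s₁ ++ s₂).toFinset := by
  rw [List.toFinset_eq_of_perm _ _ List.perm_middle, List.toFinset_cons]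

theorem mem_thresholdCodes_iff [Nonempty α] {l : List ℕ} {p : List (Finset ℕ)}
    (hl : LabelList m l) :
    p ∈ thresholdCodes m l ↔ ∃ V W : ℕ → α, (l.Pairwise fun c d => V c < V d) ∧
      comparisonCode V W l.toFinset m = p := by
  induction m generalizing l p with
  | zero =>
    obtain ⟨V, hV⟩ := exists_pairwise_lt_of_nodup (α := α) hl.nodup
    simp only [thresholdCodes, Finset.mem_singleton, comparisonCode, List.range_zero,
      List.reverse_nil, List.map_nil]
    exact ⟨fun hp => ⟨V, V, hV, hp.symm⟩, fun ⟨_, _, _, hp⟩ => hp.symm⟩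
  | succ m ih =>
    rw [mem_thresholdCodes_succ]
    constructor
    · rintro ⟨s₁, s₂, s₃, s₄, p', h₁, rfl, hp', rfl⟩
      obtain ⟨V, W, hV, rfl⟩ := (ih hl.insert).1 hp'
      have hVl := hV.sublist ((List.sublist_cons_self m s₄).append_left s₃)
      obtain ⟨w, hw₁, hw₂⟩ := exists_threshold_of_pairwise_lt (h₁ ▸ hVl)
      refine ⟨V, Function.update W m w, hVl, ?_⟩
      rw [comparisonCode_succ, comparisonCode_update_threshold, Function.update_self,
        toFinset_append_cons, h₁, filter_toFinset_append_eq hw₁ hw₂]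
    · rintro ⟨V, W, hV, rfl⟩
      have hm : m ∉ l := fun hm => (hl.le_of_mem m hm).not_gt m.lt_succ_self
      obtain ⟨s₁, s₂, h₁, hs₁, hs₂⟩ := exists_append_of_pairwise_lt hV (W m)
      obtain ⟨V', s₃, s₄, rfl, hV', hcode⟩ :=
        exists_insert_pairwise_lt hV hm W (insert m l.toFinset)
      refine ⟨s₁, s₂, s₃, s₄, _, h₁, rfl,
        (ih hl.insert).2 ⟨V', W, hV', rfl⟩, ?_⟩
      rw [comparisonCode_succ, toFinset_append_cons, hcode, h₁,
        filter_toFinset_append_eq hs₁ hs₂]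

end ComparisonCode

variable {m : ℕ} {l₁ l₂ : List ℕ} {a b : ℕ} {p : List (Finset ℕ)}

theorem mem_of_sublist_of_mem_thresholdCodes {l : List ℕ} (hl : LabelList m l)
    (hp : p ∈ thresholdCodes m l) (hab : [a, b].Sublist l) {C : Finset ℕ} (hC : C ∈ p)
    (hb : b ∈ C) : a ∈ C := by
  obtain ⟨V, W, hV, rfl⟩ := (mem_thresholdCodes_iff (α := ℝ) hl).1 hp
  exact mem_of_mem_comparisonCode (List.mem_toFinset.2 (hab.subset List.mem_cons_self))
    (List.pairwise_pair (R := fun c d => V c < V d).1 (hV.sublist hab)) hC hb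

theorem mem_thresholdCodes_swap (hl : LabelList m (l₁ ++ a :: b :: l₂))
    (hp : p ∈ thresholdCodes m (l₁ ++ a :: b :: l₂)) (hab : ∀ C ∈ p, a ∈ C ↔ b ∈ C) :
    p ∈ thresholdCodes m (l₁ ++ b :: a :: l₂) := by
  obtain ⟨V, W, hV, rfl⟩ := (mem_thresholdCodes_iff (α := ℝ) hl).1 hp
  have hperm : (l₁ ++ b :: a :: l₂).Perm (l₁ ++ a :: b :: l₂) :=
    (List.Perm.swap a b l₂).append_left l₁
  have hl' : LabelList m (l₁ ++ b :: a :: l₂) :=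
    ⟨hperm.nodup_iff.2 hl.nodup, fun c hc => hl.le_of_mem c (hperm.mem_iff.1 hc)⟩
  rw [forall_mem_comparisonCode_iff (by simp) (by simp)] at hab
  refine (mem_thresholdCodes_iff (α := ℝ) hl').2 ⟨V ∘ Equiv.swap a b, W, ?_, ?_⟩
  · have hmap : (l₁ ++ b :: a :: l₂).map (Equiv.swap a b) = l₁ ++ a :: b :: l₂ := by
      have hfix : ∀ c ∈ l₁ ++ l₂, Equiv.swap a b c = c := by
        have ha := hl.notMem_of_middle
        have hb := hl'.notMem_of_middle
        simp only [List.mem_append, List.mem_cons, not_or] at ha hb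
        intro c hc
        refine Equiv.swap_apply_of_ne_of_ne ?_ ?_ <;> rintro rfl <;> simp_all
      rw [List.forall_mem_append] at hfix
      rw [List.map_append, List.map_cons, List.map_cons, Equiv.swap_apply_left,
        Equiv.swap_apply_right, List.map_congr_left hfix.1, List.map_congr_left hfix.2,
        List.map_id', List.map_id']
    rw [← hmap, List.pairwise_map] at hV
    exact hV
  · rw [comparisonCode_comp_swap hab, List.toFinset_eq_of_perm _ _ hperm]

theorem erase_injOn_setOf_mem_iff_mem (hab : a ≠ b) :
    Set.InjOn (fun C : Finset ℕ => C.erase b) {C | a ∈ C ↔ b ∈ C} := by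
  intro C hC D hD h
  simp only [Set.mem_ofPred_eq] at hC hD
  ext c
  have h' := Finset.ext_iff.1 h
  rcases eq_or_ne c b with rfl | hcb
  · simpa [← hC, ← hD, hab] using h' a
  · simpa [hcb] using h' c

theorem map_erase_mem_thresholdCodes (hl : LabelList m (l₁ ++ b :: l₂))
    (hp : p ∈ thresholdCodes m (l₁ ++ b :: l₂)) :
    p.map (fun C => C.erase b) ∈ thresholdCodes m (l₁ ++ l₂) := by
  obtain ⟨V, W, hV, rfl⟩ := (mem_thresholdCodes_iff (α := ℝ) hl).1 hp
  refine (mem_thresholdCodes_iff (α := ℝ) hl.erase_middle).2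
    ⟨V, W, hV.sublist ((List.sublist_cons_self b l₂).append_left l₁), ?_⟩
  rw [comparisonCode_map_erase (hl.le_of_mem b (by simp)), toFinset_append_cons,
    Finset.erase_insert (mt List.mem_toFinset.1 hl.notMem_of_middle)]

theorem exists_map_erase_eq_of_mem_thresholdCodes (hl : LabelList m (l₁ ++ a :: b :: l₂))
    (hp : p ∈ thresholdCodes m (l₁ ++ a :: l₂)) :
    ∃ q ∈ thresholdCodes m (l₁ ++ a :: b :: l₂), (∀ C ∈ q, a ∈ C ↔ b ∈ C) ∧
      q.map (fun C => C.erase b) = p := by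
  rw [List.append_cons] at hl hp ⊢
  have hb := hl.notMem_of_middle
  have hmb : m ≤ b := hl.le_of_mem b (by simp)
  have hne : a ≠ b := by rintro rfl; simp at hb
  obtain ⟨V, W, hV, rfl⟩ := (mem_thresholdCodes_iff (α := ℝ) hl.erase_middle).1 hp
  -- The label `b` gets a value just above the value of `a`.
  obtain ⟨y, hay, hyV, hyW⟩ := exists_gt_same_comparisons V W l₂ m (V a)
  have hVa := List.pairwise_append.1 hV
  have hV₁ : ∀ c ∈ l₁ ++ [a], V c < y := List.forall_mem_append.2
    ⟨fun c hc => ((List.pairwise_append.1 hVa.1).2.2 c hc a (by simp)).trans hay, by simpa⟩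
  have hV₂ : ∀ c ∈ l₂, y < V c := fun c hc => hyV c hc (hVa.2.2 a (by simp) c hc)
  refine ⟨_, (mem_thresholdCodes_iff (α := ℝ) hl).2
    ⟨_, W, pairwise_lt_update_of_append hV hb hV₁ hV₂, rfl⟩, ?_, ?_⟩
  · rw [forall_mem_comparisonCode_iff (by simp) (by simp), Function.update_self,
      Function.update_of_ne hne]
    exact hyW
  · rw [← List.mem_toFinset] at hb
    rw [comparisonCode_map_erase hmb, toFinset_append_cons, Finset.erase_insert hb,
      comparisonCode_update_of_notMem hb hmb]

theorem injOn_list_map {α β : Type*} {f : α → β} {s : Set α} (hf : s.InjOn f) :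
    Set.InjOn (List.map f) {l | ∀ x ∈ l, x ∈ s} := by
  intro l hl l' hl' h
  induction l generalizing l' with
  | nil => exact (List.map_eq_nil_iff.1 h.symm).symm
  | cons x l ih =>
    obtain ⟨y, l', rfl, hxy, htail⟩ := List.map_eq_cons_iff.1 h.symm
    simp only [Set.mem_ofPred_eq, List.forall_mem_cons] at hl hl'
    rw [hf hl.1 hl'.1 hxy.symm, ih hl.2 hl'.2 htail.symm]

theorem card_filter_thresholdCodes (hl : LabelList m (l₁ ++ a :: b :: l₂)) :
    ((thresholdCodes m (l₁ ++ a :: b :: l₂)).filter fun p => ∀ C ∈ p, a ∈ C ↔ b ∈ C).card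
      = (thresholdCodes m (l₁ ++ a :: l₂)).card := by
  have hmid : LabelList m ((l₁ ++ [a]) ++ b :: l₂) := List.append_cons .. ▸ hl
  have hne : a ≠ b := by rintro rfl; simpa using hmid.notMem_of_middle
  refine Finset.card_nbij (List.map fun C => C.erase b) (fun p hp => ?_) ?_ (fun p hp => ?_)
  · rw [List.append_cons] at hp ⊢
    exact map_erase_mem_thresholdCodes hmid (Finset.mem_filter.1 hp).1
  · exact (injOn_list_map (erase_injOn_setOf_mem_iff_mem hne)).mono fun p hp =>
      (Finset.mem_filter.1 hp).2
  · obtain ⟨q, hq, hqab, rfl⟩ := exists_map_erase_eq_of_mem_thresholdCodes hl hp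
    exact ⟨q, Finset.mem_coe.2 (Finset.mem_filter.2 ⟨hq, hqab⟩), rfl⟩

-- A code possible with `m` on either side of `a` has all its sets closed under passing from `a` to
-- `m` and from `m` to `a`. Conversely, adjacent labels which a code never separates can be swapped.
theorem biUnion_thresholdCodes_inter (hl : LabelList (m + 1) (l₁ ++ a :: l₂)) :
    ((Finset.range (l₁.length + 1)).biUnion fun g =>
        thresholdCodes m ((l₁ ++ a :: l₂).take g ++ m :: (l₁ ++ a :: l₂).drop g)) ∩
      thresholdCodes m (l₁ ++ a :: m :: l₂)
      = (thresholdCodes m (l₁ ++ a :: m :: l₂)).filter fun p => ∀ C ∈ p, a ∈ C ↔ m ∈ C := by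
  have hlast := hl.insert_after
  ext p
  simp only [Finset.mem_inter, Finset.mem_biUnion, Finset.mem_range, Finset.mem_filter]
  constructor
  · rintro ⟨⟨g, hg, hp'⟩, hp⟩
    refine ⟨hp, fun C hC => ⟨fun h => ?_, fun h => ?_⟩⟩
    · have hgl : LabelList m ((l₁ ++ a :: l₂).take g ++ m :: (l₁ ++ a :: l₂).drop g) :=
        LabelList.insert (by rwa [List.take_append_drop])
      refine mem_of_sublist_of_mem_thresholdCodes hgl hp' ?_ hC h
      refine List.sublist_append_of_sublist_right (List.Sublist.cons_cons m ?_)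
      rw [List.singleton_sublist, List.drop_append_of_le_length (Nat.lt_succ_iff.1 hg)]
      simp
    · exact mem_of_sublist_of_mem_thresholdCodes hlast hp
        (List.sublist_append_of_sublist_right (by simp)) hC h
  · rintro ⟨hp, hC⟩
    refine ⟨⟨l₁.length, Nat.lt_succ_self _, ?_⟩, hp⟩
    rw [List.take_left, List.drop_left]
    exact mem_thresholdCodes_swap hlast hp hC

theorem card_biUnion_range_of_card_inter {α : Type*} [DecidableEq α] {P : ℕ → Finset α} {A B : ℤ}
    {N : ℕ} (hA : ∀ g ≤ N, ((P g).card : ℤ) = A)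
    (hB : ∀ g < N, (((Finset.range (g + 1)).biUnion P ∩ P (g + 1)).card : ℤ) = B) :
    (((Finset.range (N + 1)).biUnion P).card : ℤ) = (N + 1) * A - N * B := by
  induction N with
  | zero => simp [hA]
  | succ N ih =>
    have hcard : (((Finset.range (N + 1)).biUnion P ∪ P (N + 1)).card : ℤ) + B
        = ((Finset.range (N + 1)).biUnion P).card + A := by
      rw [← hB N N.lt_succ_self, ← hA (N + 1) le_rfl]
      exact_mod_cast Finset.card_union_add_card_inter _ _
    rw [ih (fun g hg => hA g (by omega)) fun g hg => hB g (by omega)] at hcard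
    rw [Finset.range_add_one, Finset.biUnion_insert, Finset.union_comm, eq_sub_of_add_eq hcard]
    push_cast
    ring

theorem card_image_take_toFinset {l : List ℕ} (hl : l.Nodup) :
    ((Finset.range (l.length + 1)).image fun i => (l.take i).toFinset).card = l.length + 1 := by
  rw [Finset.card_image_of_injOn, Finset.card_range]
  intro i hi j hj h
  have h' := congrArg Finset.card h
  simp only [Finset.coe_range, Set.mem_Iio] at hi hj
  rw [List.toFinset_card_of_nodup (hl.sublist (List.take_sublist i l)),
    List.toFinset_card_of_nodup (hl.sublist (List.take_sublist j l)),
    List.length_take, List.length_take] at h'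
  omega

theorem card_biUnion_thresholdCodes_inter (hl : LabelList (m + 1) (l₁ ++ a :: l₂)) :
    ((Finset.range (l₁.length + 1)).biUnion (fun g =>
        thresholdCodes m ((l₁ ++ a :: l₂).take g ++ m :: (l₁ ++ a :: l₂).drop g)) ∩
      thresholdCodes m (l₁ ++ a :: m :: l₂)).card = (thresholdCodes m (l₁ ++ a :: l₂)).card := by
  rw [biUnion_thresholdCodes_inter hl, card_filter_thresholdCodes hl.insert_after]

theorem card_thresholdCodes {l : List ℕ} (hl : LabelList m l) :
    ((thresholdCodes m l).card : ℤ) = gandhiValue m l.length := by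
  induction m generalizing l with
  | zero => simp [thresholdCodes, gandhiValue]
  | succ m ih =>
    have hunion := card_biUnion_range_of_card_inter (N := l.length)
      (P := fun g => thresholdCodes m (l.take g ++ m :: l.drop g))
      (A := gandhiValue m (l.length + 1)) (B := gandhiValue m l.length) (fun g _ => ?_)
      fun g hg => ?_
    · rw [thresholdCodes, Finset.card_image₂ fun _ _ _ _ h => List.cons_eq_cons.1 h,
        card_image_take_toFinset hl.nodup, gandhiValue, Nat.cast_mul, hunion]
      push_cast
      ring
    · have hins : LabelList m (l.take g ++ m :: l.drop g) :=
        LabelList.insert (by rwa [List.take_append_drop])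
      rw [ih hins, List.perm_middle.length_eq, List.length_cons, List.take_append_drop]
    · obtain ⟨l₁, a, l₂, rfl, rfl⟩ : ∃ l₁ a l₂, l = l₁ ++ a :: l₂ ∧ l₁.length = g :=
        ⟨l.take g, l[g], l.drop (g + 1), by simp, by simpa using hg.le⟩
      have hnext : (l₁ ++ a :: l₂).take (l₁.length + 1) ++
          m :: (l₁ ++ a :: l₂).drop (l₁.length + 1) = l₁ ++ a :: m :: l₂ := by
        simp [List.take_length_add_append, List.drop_length_add_append]
      rw [hnext, card_biUnion_thresholdCodes_inter hl,
        ih ⟨hl.nodup, fun c hc => (Nat.le_succ m).trans (hl.le_of_mem c hc)⟩]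

end ThresholdCodes

section Regions

section StaircaseArrangement

variable {E : Type*} [AddCommGroup E] [Module ℝ E] {f g : E →ᵃ[ℝ] ℝ} {x y z : E}

theorem ne_of_mem_segment_of_lt_iff_lt (hx : f x ≠ g x) (hy : f y ≠ g y)
    (h : g x < f x ↔ g y < f y) (hz : z ∈ segment ℝ x y) : f z ≠ g z := by
  have hconvex (s : Set ℝ) (hs : Convex ℝ s) (hxs : (f - g) x ∈ s) (hys : (f - g) y ∈ s) :
      (f - g) z ∈ s :=
    (hs.affine_preimage (f - g)).segment_subset hxs hys hz
  rcases hx.lt_or_gt with hxlt | hxgt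
  · have hylt : f y < g y := hy.lt_of_le (not_lt.1 (mt h.2 hxlt.not_gt))
    exact (sub_neg.1 (hconvex _ (convex_Iio 0) (sub_neg.2 hxlt) (sub_neg.2 hylt))).ne
  · have hygt : g y < f y := h.1 hxgt
    exact (sub_pos.1 (hconvex _ (convex_Ioi 0) (sub_pos.2 hxgt) (sub_pos.2 hygt))).ne'

/-- The arrangement of the sets `u i = w j`, `i < j`: two affine functionals for each index are
compared, the first one of `i` with the second one of `j`. For `u i = x i - a i` and `w j = x j` it
is the `a`-generalized Linial arrangement. -/
def staircaseArrangement {n : ℕ} (u w : Fin n → E →ᵃ[ℝ] ℝ) : Set (Set E) :=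
  {H | ∃ i j, i < j ∧ H = {x | u i x = w j x}}

theorem mem_compl_sUnion_staircaseArrangement_iff {n : ℕ} {u w : Fin n → E →ᵃ[ℝ] ℝ} :
    x ∈ (⋃₀ staircaseArrangement u w)ᶜ ↔ ∀ i j, i < j → u i x ≠ w j x := by
  simp only [staircaseArrangement, Set.mem_compl_iff, Set.mem_sUnion, Set.mem_ofPred_eq]
  constructor
  · exact fun hx i j hij h => hx ⟨_, ⟨i, j, hij, rfl⟩, h⟩
  · rintro hx ⟨_, ⟨i, j, hij, rfl⟩, h⟩
    exact hx i j hij h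

end StaircaseArrangement

section TopologicalVectorSpace

variable {E : Type*} [AddCommGroup E] [Module ℝ E] [TopologicalSpace E] [ContinuousAdd E]
  [ContinuousSMul ℝ E] {x y : E}

theorem connectedComponentIn_eq_of_segment_subset {s : Set E} (h : segment ℝ x y ⊆ s) :
    connectedComponentIn s x = connectedComponentIn s y :=
  connectedComponentIn_eq <|
    (convex_segment x y).isPreconnected.subset_connectedComponentIn (left_mem_segment ℝ x y) h
      (right_mem_segment ℝ x y)

theorem connectedComponentIn_staircaseArrangement_eq {n : ℕ} {u w : Fin n → E →ᵃ[ℝ] ℝ}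
    (hx : x ∈ (⋃₀ staircaseArrangement u w)ᶜ) (hy : y ∈ (⋃₀ staircaseArrangement u w)ᶜ)
    (h : ∀ i j, i < j → (w j x < u i x ↔ w j y < u i y)) :
    connectedComponentIn (⋃₀ staircaseArrangement u w)ᶜ x
      = connectedComponentIn (⋃₀ staircaseArrangement u w)ᶜ y := by
  refine connectedComponentIn_eq_of_segment_subset fun z hz => ?_
  rw [mem_compl_sUnion_staircaseArrangement_iff] at hx hy ⊢
  exact fun i j hij => ne_of_mem_segment_of_lt_iff_lt (hx i j hij) (hy i j hij) (h i j hij) hz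

end TopologicalVectorSpace

theorem encard_arrangementRegions_le {E β : Type*} [TopologicalSpace E] {𝒜 : Set (Set E)}
    (code : E → β) (F : Finset β) (hF : ∀ x ∈ (⋃₀ 𝒜)ᶜ, code x ∈ F)
    (hcode : ∀ x ∈ (⋃₀ 𝒜)ᶜ, ∀ y ∈ (⋃₀ 𝒜)ᶜ, code x = code y →
      connectedComponentIn (⋃₀ 𝒜)ᶜ x = connectedComponentIn (⋃₀ 𝒜)ᶜ y) :
    (arrangementRegions 𝒜).encard ≤ F.card := by
  let region (x : ↥(⋃₀ 𝒜)ᶜ) : Set E := connectedComponentIn (⋃₀ 𝒜)ᶜ x.1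
  have hregion : region.FactorsThrough fun x => code x.1 := fun x y => hcode x.1 x.2 y.1 y.2
  have hsub : arrangementRegions 𝒜
      ⊆ Function.extend (fun x : ↥(⋃₀ 𝒜)ᶜ => code x.1) region (fun _ => ∅) '' (F : Set β) := by
    rintro _ ⟨x, hx, rfl⟩
    exact ⟨code x, hF x hx, hregion.extend_apply _ ⟨x, hx⟩⟩
  calc (arrangementRegions 𝒜).encard
    _ ≤ (F : Set β).encard := (Set.encard_le_encard hsub).trans (Set.encard_image_le _ _)
    _ = F.card := Set.encard_coe_eq_coe_finsetCard F

section PointCode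

variable {E : Type*} [AddCommGroup E] [Module ℝ E] {m : ℕ} {u w : Fin (m + 1) → E →ᵃ[ℝ] ℝ}
  {x y : E}

/-- The code of a point: the label `c` has the value `w c x`, and the threshold of the round `i` is
`u i x`. Thus the round `i` records the `j > i` with `w j x < u i x`. -/
noncomputable def pointCode (u w : Fin (m + 1) → E →ᵃ[ℝ] ℝ) (x : E) : List (Finset ℕ) :=
  comparisonCode (fun c => w (Fin.ofNat (m + 1) c) x) (fun i => u (Fin.ofNat (m + 1) i) x) {m} m

theorem labelList_singleton (m : ℕ) : LabelList m [m] where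
  nodup := List.nodup_singleton m
  le_of_mem _ hc := (List.mem_singleton.1 hc).ge

theorem pointCode_mem_thresholdCodes : pointCode u w x ∈ thresholdCodes m [m] :=
  (mem_thresholdCodes_iff (labelList_singleton m)).2
    ⟨_, _, List.pairwise_singleton _ m, rfl⟩

theorem lt_iff_lt_of_pointCode_eq (h : pointCode u w x = pointCode u w y) {i j : Fin (m + 1)}
    (hij : i < j) : w j x < u i x ↔ w j y < u i y := by
  have hmem : (j : ℕ) ∈ {m} ∪ Finset.Ioo (i : ℕ) m := by
    simp only [Finset.mem_union, Finset.mem_singleton, Finset.mem_Ioo]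
    omega
  simpa using comparisonCode_eq_iff.1 h i (by omega) j hmem

end PointCode

theorem card_thresholdCodes_singleton (m : ℕ) :
    (thresholdCodes m [m]).card = medianGenocchi (m + 1) := by
  have h := card_thresholdCodes (labelList_singleton m)
  rw [List.length_singleton, gandhiValue_one] at h
  exact_mod_cast h

theorem mainTheorem12_general {E : Type*} [AddCommGroup E] [Module ℝ E] [TopologicalSpace E]
    [ContinuousAdd E] [ContinuousSMul ℝ E] {n : ℕ} (hn : 1 ≤ n) (u w : Fin n → E →ᵃ[ℝ] ℝ) :
    (arrangementRegions (staircaseArrangement u w)).encard ≤ (medianGenocchi n : ℕ∞) := by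
  obtain ⟨m, rfl⟩ := Nat.exists_eq_add_of_le' hn
  rw [← card_thresholdCodes_singleton]
  exact encard_arrangementRegions_le (pointCode u w) _ (fun _ _ => pointCode_mem_thresholdCodes)
    fun x hx y hy h => connectedComponentIn_staircaseArrangement_eq hx hy fun _ _ =>
      lt_iff_lt_of_pointCode_eq h

/-- The `i`-th coordinate of the points of `V_{n-1}`. -/
noncomputable def sumZeroSpaceCoord {n : ℕ} (i : Fin n) : sumZeroSpace n →ᵃ[ℝ] ℝ :=
  ((EuclideanSpace.projₗ i).comp (sumZeroSpace n).subtype).toAffineMap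

theorem sumZeroSpaceCoord_apply {n : ℕ} (i : Fin n) (x : sumZeroSpace n) :
    sumZeroSpaceCoord i x = x.1 i :=
  rfl

theorem generalizedLinialArrangement_eq_staircaseArrangement {n : ℕ} (a : Fin n → ℝ) :
    generalizedLinialArrangement a
      = staircaseArrangement (fun i => sumZeroSpaceCoord i - AffineMap.const ℝ _ (a i))
          sumZeroSpaceCoord := by
  simp only [generalizedLinialArrangement, staircaseArrangement, AffineMap.coe_sub, Pi.sub_apply,
    AffineMap.const_apply, sumZeroSpaceCoord_apply, sub_eq_iff_eq_add, add_comm]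

end Regions

theorem mainTheorem12 (n : ℕ) (hn : 1 ≤ n) (a : Fin n → ℝ) (ha : ∀ i, 0 ≤ a i) :
    (arrangementRegions (generalizedLinialArrangement a)).encard ≤ (medianGenocchi n : ℕ∞) := by
  rw [generalizedLinialArrangement_eq_staircaseArrangement]
  exact mainTheorem12_general hn _ _
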